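/- Let $p$ be a prime, let $F$ be a field of characteristic $p$, and let $G$ and $H$ be finite $p$-groups. For a finite $p$-group $P$ let $\mathrm{Soc}(P)$ be the subgroup generated by the central elements of prime order, and let $\Phi(P)$ be the Frattini subgroup. An internal direct decomposition $P = A \times B$ into subgroups $A$, $B$ is called elementary if (1) $A \cap \Phi(P) = 1$ and $|A| = |\mathrm{Soc}(P) : \mathrm{Soc}(P) \cap \Phi(P)|$; and (2) $\mathrm{Soc}(P)\,B = P$ and $|B| = |P| / |\mathrm{Soc}(P) : \mathrm{Soc}(P) \cap \Phi(P)|$. (a) Let $G = T \times U$ and $H = S \times V$ be elementary decompositions with $T$ and $S$ elementary abelian. Then $FG \cong FH$ as $F$-algebras if and only if $FT \cong FS$ and $FU \cong FV$ as $F$-algebras. (b) In particular, if $E$ is a finite elementary abelian $p$-group and $F[E \times G] \cong F[E \times H]$ as $F$-algebras, then $FG \cong FH$ as $F$-algebras. Here the trivial group is regarded as elementary abelian. -/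

import Mathlib

namespace ModularIso

/-- `G` is an elementary abelian `p`-group: it is abelian and all its elements satisfy `g ^ p = 1`
(the trivial group is allowed). -/
def IsElementaryAbelian (p : ℕ) (G : Type*) [Group G] : Prop :=
  (∀ a b : G, a * b = b * a) ∧ ∀ a : G, a ^ p = 1

/-- The socle of a finite `p`-group: the subgroup generated by the central elements of prime
order. -/
def soc (G : Type*) [Group G] : Subgroup G :=
  Subgroup.closure {g : G | g ∈ Subgroup.center G ∧ (orderOf g).Prime}

/-- `G` is the internal direct product `T × U` of its subgroups `T` and `U`. -/
structure IsInternalDirectProduct {G : Type*} [Group G] (T U : Subgroup G) : Prop where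
  commute : ∀ t ∈ T, ∀ u ∈ U, t * u = u * t
  inf_eq_bot : T ⊓ U = ⊥
  sup_eq_top : T ⊔ U = ⊤

/-- The decomposition `G = T × U` of the finite group `G` is elementary:
`T ∩ Φ(G) = 1`, `|T| = |Soc(G) : Soc(G) ∩ Φ(G)|`, `Soc(G) U = G` and
`|U| = |G| / |Soc(G) : Soc(G) ∩ Φ(G)|`, where `Φ(G)` is the Frattini subgroup.
As `Soc(G)` is central, the product `Soc(G) U` is the join of the two subgroups. -/
structure IsElementaryDecomposition {G : Type*} [Group G] (T U : Subgroup G) : Prop where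
  directProduct : IsInternalDirectProduct T U
  inf_frattini : T ⊓ frattini G = ⊥
  card_left : Nat.card T = (soc G ⊓ frattini G).relIndex (soc G)
  soc_sup : soc G ⊔ U = ⊤
  card_right : Nat.card U * (soc G ⊓ frattini G).relIndex (soc G) = Nat.card G

end ModularIso

/-! Let `J` denote an augmentation ideal. The core is a cancellation result
(`cancel_elementaryAbelian`): if `F[T × U] ≅ F[S × V]` with `T`, `S` elementary abelian, and if in
`U` and `V` every central `s` with `s ^ p = 1` has `s - 1 ∈ J ^ 2`, then `|T| = |S|` and `FU ≅ FV`.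

The isomorphism yields a map `FV → F[S × V] → F[T × U] → FU`; it suffices that it is onto, since by
symmetry and a dimension count it is then bijective. For surjectivity one needs to control `s - 1`
for `s ∈ S`. It is central with zero `p`-th power, and `mem_of_pow_eq_zero` shows that such elements
of `J` are, modulo `J ^ 2`, combinations of `c - 1` with `c` central and `c ^ p = 1`. In `F[T × U]`
these reduce to the `t - 1` with `t ∈ T`, which die in `FU`. So the image of `FV` suffices modulo `J
^ 2`, and nilpotency of `J` finishes (`subalgebra_eq_top`).

For (a), elements of the Frattini subgroup are `1` modulo `J ^ 2`, so elementary decompositions have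
complements of the required kind. For (b), linear algebra modulo `J ^ 2` produces a suitable
decomposition of any group, and `E` is absorbed into the elementary abelian factor. -/

namespace ModularIso

open MonoidAlgebra

/-! ### Sums of invariant functions in characteristic `p` -/

section FixedPoints

variable {p : ℕ} [Fact p.Prime] {G : Type*} [Group G]

/-- In an abelian group of exponent `p`, the sum of the values of an invariant function over a
finite set acted on by a `p`-group is its sum over the fixed points. -/
theorem sum_eq_sum_fixedPoints (hG : IsPGroup p G) {X : Type*} [Fintype X] [MulAction G X]
    [DecidablePred (· ∈ MulAction.fixedPoints G X)]
    {M : Type*} [AddCommGroup M] (hM : ∀ m : M, p • m = 0) (f : X → M)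
    (hf : ∀ (g : G) (x : X), f (g • x) = f x) :
    ∑ x, f x = ∑ x with x ∈ MulAction.fixedPoints G X, f x := by
  classical
  rw [← Finset.sum_filter_add_sum_filter_not Finset.univ
    (fun x => x ∈ MulAction.fixedPoints G X) f, add_eq_left]
  have key := Finset.sum_comp (s := Finset.univ.filter
    (fun x => ¬ x ∈ MulAction.fixedPoints G X)) (fun m : M => m) f
  rw [key]
  refine Finset.sum_eq_zero fun b _ => ?_
  -- The non-fixed points where `f` takes the value `b` form a `G`-set without fixed points, so
  -- their number is divisible by `p`.
  let Y : SubMulAction G X :=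
    { carrier := {x | x ∉ MulAction.fixedPoints G X ∧ f x = b}
      smul_mem' := by
        rintro g x ⟨hx, rfl⟩
        refine ⟨fun h => hx ?_, hf g x⟩
        have h1 := h g⁻¹
        rw [inv_smul_smul] at h1
        rw [h1]
        exact h }
  have hY : Nat.card Y ≡ Nat.card (MulAction.fixedPoints G Y) [MOD p] :=
    hG.card_modEq_card_fixedPoints Y
  have hempty : IsEmpty (MulAction.fixedPoints G Y) := by
    refine ⟨fun y => y.1.2.1 fun g => ?_⟩
    exact congrArg Subtype.val (y.2 g)
  rw [Nat.card_eq_zero.2 (Or.inl hempty)] at hY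
  obtain ⟨k, hk⟩ := (Nat.modEq_zero_iff_dvd).1 hY
  have hc : Nat.card Y = (Finset.filter (fun a => f a = b)
      (Finset.univ.filter (fun x => ¬ x ∈ MulAction.fixedPoints G X))).card := by
    rw [Finset.filter_filter, ← Fintype.card_subtype, ← Nat.card_eq_fintype_card]
    rfl
  rw [← hc, hk, mul_comm, mul_smul, hM, smul_zero]

/-- The sum of a class function on a finite `p`-group with values in an abelian group of
exponent `p` is its sum over the center. -/
theorem sum_eq_sum_center [Fintype G] [Fintype (Subgroup.center G)] (hG : IsPGroup p G)
    {M : Type*} [AddCommGroup M]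
    (hM : ∀ m : M, p • m = 0) (f : G → M) (hf : ∀ g x : G, f (g * x * g⁻¹) = f x) :
    ∑ x, f x = ∑ x : Subgroup.center G, f x := by
  classical
  rw [sum_eq_sum_fixedPoints (G := ConjAct G) (p := p)
    (hG.of_equiv ConjAct.toConjAct) hM f (fun g x => by rw [ConjAct.smul_def]; exact hf _ _)]
  refine Finset.sum_subtype _ (fun x => ?_) _
  rw [Finset.mem_filter, ConjAct.fixedPoints_eq_center]
  simp

end FixedPoints

/-! ### The augmentation ideal and its square -/

section Augmentation

variable (F : Type*) [Field F] (G : Type*) [Group G]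

/-- The augmentation of a group algebra. -/
noncomputable def aug : MonoidAlgebra F G →ₐ[F] F := MonoidAlgebra.lift F F G 1

/-- The augmentation ideal of a group algebra, as a subspace. -/
noncomputable def augIdeal : Submodule F (MonoidAlgebra F G) :=
  LinearMap.ker (aug F G).toLinearMap

variable {F G}

@[simp] theorem aug_single (g : G) (a : F) : aug F G (single g a) = a := by simp [aug]

theorem mem_augIdeal {x : MonoidAlgebra F G} : x ∈ augIdeal F G ↔ aug F G x = 0 := Iff.rfl

theorem of_sub_one_mem (g : G) : of F G g - 1 ∈ augIdeal F G := by
  simp [mem_augIdeal]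

theorem mul_mem_augIdeal_left (x : MonoidAlgebra F G) {y : MonoidAlgebra F G}
    (hy : y ∈ augIdeal F G) : x * y ∈ augIdeal F G := by
  rw [mem_augIdeal] at *
  simp [hy]

theorem mul_mem_augIdeal_right {x : MonoidAlgebra F G} (y : MonoidAlgebra F G)
    (hx : x ∈ augIdeal F G) : x * y ∈ augIdeal F G := by
  rw [mem_augIdeal] at *
  simp [hx]

theorem augIdeal_mul_le : augIdeal F G * augIdeal F G ≤ augIdeal F G :=
  Submodule.mul_le.2 fun x _ _ hy => mul_mem_augIdeal_left x hy

theorem map_augIdeal_mul_le {H : Type*} [Group H] (f : MonoidAlgebra F G →ₐ[F] MonoidAlgebra F H)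
    (hf : ∀ x, aug F H (f x) = aug F G x) {x : MonoidAlgebra F G}
    (hx : x ∈ augIdeal F G * augIdeal F G) : f x ∈ augIdeal F H * augIdeal F H := by
  induction hx using Submodule.mul_induction_on' with
  | mem_mul_mem a ha b hb =>
    rw [map_mul]
    exact Submodule.mul_mem_mul (by rwa [mem_augIdeal, hf]) (by rwa [mem_augIdeal, hf])
  | add a _ b _ iha ihb => rw [map_add]; exact add_mem iha ihb

theorem aug_mapDomain {H : Type*} [Group H] (f : G →* H) (x : MonoidAlgebra F G) :
    aug F H (mapDomainAlgHom F F f x) = aug F G x := by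
  have : (aug F H).comp (mapDomainAlgHom F F f) = aug F G := by
    ext; simp
  exact DFunLike.congr_fun this x

theorem of_sub_one_map {H : Type*} [Group H] (f : G →* H) {g : G}
    (hg : of F G g - 1 ∈ augIdeal F G * augIdeal F G) :
    of F H (f g) - 1 ∈ augIdeal F H * augIdeal F H := by
  have := map_augIdeal_mul_le (mapDomainAlgHom F F f) (aug_mapDomain f) hg
  rw [map_sub, map_one] at this
  simpa using this

/-- The homomorphism `g ↦ g - 1` to the quotient of the group algebra by a subspace containing the
square of the augmentation ideal. -/
noncomputable def quotHom (N : Submodule F (MonoidAlgebra F G))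
    (hN : augIdeal F G * augIdeal F G ≤ N) : G →* Multiplicative (MonoidAlgebra F G ⧸ N) where
  toFun g := Multiplicative.ofAdd (N.mkQ (of F G g - 1))
  map_one' := by rw [map_one, sub_self, map_zero, ofAdd_zero]
  map_mul' g h := by
    rw [← ofAdd_add, ← map_add]
    congr 1
    rw [← sub_eq_zero, ← map_sub]
    refine (Submodule.Quotient.mk_eq_zero N).2 (hN ?_)
    have : of F G (g * h) - 1 - (of F G g - 1 + (of F G h - 1))
        = (of F G g - 1) * (of F G h - 1) := by
      rw [map_mul]; noncomm_ring
    rw [this]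
    exact Submodule.mul_mem_mul (of_sub_one_mem g) (of_sub_one_mem h)

theorem toAdd_quotHom (N : Submodule F (MonoidAlgebra F G))
    (hN : augIdeal F G * augIdeal F G ≤ N) (g : G) :
    (quotHom N hN g).toAdd = N.mkQ (of F G g - 1) := rfl

theorem mem_ker_quotHom (N : Submodule F (MonoidAlgebra F G))
    (hN : augIdeal F G * augIdeal F G ≤ N) {g : G} :
    g ∈ (quotHom N hN).ker ↔ of F G g - 1 ∈ N := by
  rw [MonoidHom.mem_ker, ← Submodule.Quotient.mk_eq_zero N]
  exact Iff.rfl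

theorem sum_coeff_eq_aug [Fintype G] (x : MonoidAlgebra F G) :
    ∑ g, x.coeff g = aug F G x := by
  rw [aug, lift_apply, Finsupp.sum_fintype _ _ (by simp)]
  simp

theorem eq_sum_smul_of [Fintype G] (x : MonoidAlgebra F G) :
    x = ∑ g, x.coeff g • of F G g := by
  conv_lhs => rw [← sum_coeff_single x]
  rw [Finsupp.sum_fintype _ _ (by simp)]
  simp

theorem eq_sum_smul_of_sub_one [Fintype G] {x : MonoidAlgebra F G} (hx : x ∈ augIdeal F G) :
    x = ∑ g, x.coeff g • (of F G g - 1) := by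
  simp_rw [smul_sub]
  rw [Finset.sum_sub_distrib, ← Finset.sum_smul, sum_coeff_eq_aug, mem_augIdeal.1 hx,
    zero_smul, sub_zero]
  exact eq_sum_smul_of x

theorem augIdeal_le_iff [Finite G] {N : Submodule F (MonoidAlgebra F G)} :
    augIdeal F G ≤ N ↔ ∀ g, of F G g - 1 ∈ N := by
  have := Fintype.ofFinite G
  refine ⟨fun h g => h (of_sub_one_mem g), fun h x hx => ?_⟩
  rw [eq_sum_smul_of_sub_one hx]
  exact Submodule.sum_mem _ fun g _ => N.smul_mem _ (h g)

end Augmentation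

/-! ### Central `p`-nilpotent elements modulo `J ^ 2` -/

theorem nsmul_char_eq_zero (F : Type*) [Field F] {p : ℕ} [CharP F p] {M : Type*}
    [AddCommGroup M] [Module F M] (m : M) : p • m = 0 := by
  rw [← Nat.cast_smul_eq_nsmul F, CharP.cast_eq_zero, zero_smul]

section CharP

variable {p : ℕ} [Fact p.Prime] {F : Type*} [Field F] [CharP F p] {G : Type*} [Group G]

/-- Every `F`-algebra homomorphism from the group algebra of a `p`-group to a group algebra respects
the augmentation. -/
theorem aug_map (hG : IsPGroup p G) {H : Type*} [Group H]
    (f : MonoidAlgebra F G →ₐ[F] MonoidAlgebra F H) (x : MonoidAlgebra F G) :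
    aug F H (f x) = aug F G x := by
  have : (aug F H).comp f = aug F G := by
    refine MonoidAlgebra.algHom_ext (R := F) (A := F) (M := G) (fun g => ?_)
      (by ext)
    obtain ⟨k, hk⟩ := isPGroup_iff_pow_pow_eq_one.1 hG g
    have h1 : ((aug F H).comp f (single g (1 : F))) ^ p ^ k = 1 := by
      rw [← map_pow, single_pow, hk, one_pow, ← one_def, map_one]
    rw [aug_single]
    -- A field of characteristic `p` has no root of unity of `p`-power order except `1`.
    have h2 : ((aug F H).comp f (single g (1 : F)) - 1) ^ p ^ k = 0 := by
      rw [sub_pow_char_pow, h1, one_pow, sub_self]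
    exact sub_eq_zero.1 (eq_zero_of_pow_eq_zero h2)
  exact DFunLike.congr_fun this x

theorem coeff_conj {z : MonoidAlgebra F G} (hz : ∀ x, z * x = x * z) (g x : G) :
    z.coeff (g * x * g⁻¹) = z.coeff x := by
  have h := congrArg (fun y => y.coeff (g * x)) (hz (of F G g))
  simp only [of_apply, coeff_mul_single_apply, coeff_single_mul_apply] at h
  simpa using h

/-- Restricting coefficients to the center of a finite `p`-group is multiplicative on the center
of its group algebra. -/
theorem comapDomain_center_mul [Finite G] (hG : IsPGroup p G) {z w : MonoidAlgebra F G}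
    (hz : ∀ x, z * x = x * z) (hw : ∀ x, w * x = x * w) :
    comapDomain (Subgroup.center G).subtype (Subgroup.subtype_injective _) (z * w) =
      comapDomain (Subgroup.center G).subtype (Subgroup.subtype_injective _) z *
      comapDomain (Subgroup.center G).subtype (Subgroup.subtype_injective _) w := by
  have := Fintype.ofFinite G
  have := Fintype.ofFinite (Subgroup.center G)
  ext c
  rw [coeff_mul_apply_left, Finsupp.sum_fintype _ _ (by simp)]
  simp only [coeff_comapDomain, Finsupp.comapDomain_apply]
  rw [coeff_mul_apply_left, Finsupp.sum_fintype _ _ (by simp),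
    sum_eq_sum_center (p := p) hG (nsmul_char_eq_zero F)]
  · simp
  -- The summand `z(x) w(x⁻¹ c)` is a class function of `x` because `c` is central.
  · intro g x
    rw [coeff_conj hz, ← coeff_conj hw g (x⁻¹ * _)]
    congr 2
    have hc : g * (c : G) = c * g := Subgroup.mem_center_iff.1 c.2 g
    simp only [mul_inv_rev, inv_inv, Subgroup.subtype_apply, mul_assoc]
    rw [Subgroup.mem_center_iff.1 c.2 g⁻¹]

theorem comapDomain_center_pow [Finite G] (hG : IsPGroup p G) {z : MonoidAlgebra F G}
    (hz : ∀ x, z * x = x * z) {n : ℕ} (hn : n ≠ 0) :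
    comapDomain (Subgroup.center G).subtype (Subgroup.subtype_injective _) (z ^ n) =
      comapDomain (Subgroup.center G).subtype (Subgroup.subtype_injective _) z ^ n := by
  induction n, Nat.one_le_iff_ne_zero.2 hn using Nat.le_induction with
  | base => simp
  | succ n h ih =>
    rw [pow_succ, comapDomain_center_mul hG _ hz, ih (by lia), pow_succ]
    exact fun x => ((show Commute z x from hz x).pow_left n)

open scoped IsMulCommutative in
/-- A `p`-nilpotent central element of the augmentation ideal lies in every subspace that contains
the square of the augmentation ideal and all `s - 1` for `s` central with `s ^ p = 1`. -/
theorem mem_of_pow_eq_zero [Finite G] (hG : IsPGroup p G) {N : Submodule F (MonoidAlgebra F G)}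
    (hN : augIdeal F G * augIdeal F G ≤ N)
    (hs : ∀ s ∈ Subgroup.center G, s ^ p = 1 → of F G s - 1 ∈ N)
    {z : MonoidAlgebra F G} (hz : ∀ x, z * x = x * z) (hz1 : z ∈ augIdeal F G)
    (hzp : z ^ p = 0) : z ∈ N := by
  have hp : p ≠ 0 := (Fact.out : p.Prime).ne_zero
  have := Fintype.ofFinite G
  have := Fintype.ofFinite (Subgroup.center G)
  rw [← Submodule.Quotient.mk_eq_zero N, ← Submodule.mkQ_apply]
  -- Modulo `N` the map `g ↦ g - 1` is a homomorphism to an abelian group, hence a class function,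
  -- so only central terms survive.
  have h1 : N.mkQ z = ∑ c : Subgroup.center G, z.coeff c • N.mkQ (of F G c - 1) := by
    conv_lhs => rw [eq_sum_smul_of_sub_one hz1]
    rw [map_sum]
    simp_rw [map_smul]
    rw [sum_eq_sum_center (p := p) hG (nsmul_char_eq_zero F)]
    intro g x
    have h : quotHom N hN (g * x * g⁻¹) = quotHom N hN x := by
      rw [map_mul, map_mul, map_inv, mul_inv_cancel_comm]
    rw [coeff_conj hz, ← toAdd_quotHom N hN, ← toAdd_quotHom N hN, h]
  rw [h1]
  set y := comapDomain (Subgroup.center G).subtype (Subgroup.subtype_injective _) z with hy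
  have hyp : y ^ p = 0 := by
    rw [hy, ← comapDomain_center_pow hG hz hp, hzp, comapDomain_zero]
  let q : Subgroup.center G →* Subgroup.center G :=
    { toFun c := c ^ p
      map_one' := one_pow p
      map_mul' a b := mul_pow a b p }
  have h2 : mapDomain q y = 0 := by
    have hCP : CharP (MonoidAlgebra F (Subgroup.center G)) p :=
      charP_of_injective_algebraMap (algebraMap F _).injective p
    -- In the commutative algebra of the center, the `p`-th power is the push-forward along `c ↦ c ^
    -- p` followed by Frobenius on coefficients, which is injective.
    have e1 : y ^ p = map (frobenius F p : F →+ F) (mapDomain q y) := by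
      conv_lhs => rw [eq_sum_smul_of y]
      conv_rhs => rw [eq_sum_smul_of y]
      rw [sum_pow_char]
      rw [show mapDomain q (∑ g, y.coeff g • of F _ g) =
        mapDomainAlgHom F F q (∑ g, y.coeff g • of F _ g) from rfl, map_sum]
      have e2 : ∀ x, map (frobenius F p : F →+ F) x =
        mapRingHom (Subgroup.center G) (frobenius F p) x := fun _ => rfl
      rw [e2, map_sum]
      refine Finset.sum_congr rfl fun c _ => ?_
      simp [q, frobenius_def, single_pow]
    rw [hyp] at e1
    have := map_injective (M := Subgroup.center G) (frobenius F p : F →+ F)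
      (frobenius_inj F p)
    exact this (by rw [← e1, MonoidAlgebra.map_zero])
  -- By `hs`, the class of `c - 1` depends only on `c ^ p`, so the sum in `h1` is a linear image of
  -- the vanishing push-forward of `y`.
  have h3 : Function.FactorsThrough (fun c : Subgroup.center G => N.mkQ (of F G c - 1)) q := by
    intro a b hab
    have hk : (a * b⁻¹ : Subgroup.center G) ^ p = 1 := by
      rw [mul_pow, inv_pow, mul_inv_eq_one]; exact hab
    have := (mem_ker_quotHom N hN).2 (hs _ (a * b⁻¹).2
      (by simpa using congrArg Subtype.val hk))
    rw [MonoidHom.mem_ker, Subgroup.coe_mul, map_mul, Subgroup.coe_inv, map_inv,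
      mul_inv_eq_one] at this
    exact this
  let d := Function.extend q (fun c : Subgroup.center G => N.mkQ (of F G c - 1)) 0
  have hd : ∀ c, d (q c) = N.mkQ (of F G c - 1) := fun c => h3.extend_apply _ c
  have h4 : Finsupp.linearCombination F d (Finsupp.mapDomain q y.coeff) = 0 := by
    have : Finsupp.mapDomain q y.coeff = 0 := congrArg coeff h2
    rw [this, _root_.map_zero]
  rw [Finsupp.linearCombination_mapDomain, Finsupp.linearCombination_apply,
    Finsupp.sum_fintype _ _ (by simp)] at h4
  rw [← h4]
  refine Finset.sum_congr rfl fun c _ => ?_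
  rw [Function.comp_apply, hd]
  rfl

end CharP

/-! ### Nilpotency of the augmentation ideal and generation modulo its square -/

section Nilpotent

variable {p : ℕ} [Fact p.Prime] {F : Type*} [Field F] [CharP F p] {G : Type*} [Group G] [Finite G]

/-- A finite `p`-group acting linearly in characteristic `p` on a nonzero module has a nonzero
invariant vector. -/
theorem exists_ne_zero_forall_of_smul_eq (hG : IsPGroup p G) (M : Type*) [AddCommGroup M]
    [Module (MonoidAlgebra F G) M] [Nontrivial M] :
    ∃ x : M, x ≠ 0 ∧ ∀ g : G, of F G g • x = x := by
  have hM : ∀ m : M, p • m = 0 := fun m => by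
    rw [← Nat.cast_smul_eq_nsmul (MonoidAlgebra F G),
      ← map_natCast (algebraMap F (MonoidAlgebra F G)), CharP.cast_eq_zero, map_zero, zero_smul]
  obtain ⟨x, hx⟩ := exists_ne (0 : M)
  have inst : Module (ZMod p) M := AddCommGroup.zmodModule hM
  -- `F` and `M` may be infinite; the span of one orbit over the prime field is a finite `G`-set, so
  -- fixed points can be counted modulo `p`.
  let S : Submodule (ZMod p) M := Submodule.span (ZMod p) (Set.range fun g : G => of F G g • x)
  have hxS : x ∈ S := by
    have h : x ∈ Set.range fun g : G => of F G g • x := ⟨1, by simp only [map_one, one_smul]⟩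
    exact Submodule.subset_span h
  have hS : ∀ (g : G) (y : M), y ∈ S → of F G g • y ∈ S := by
    intro g y hy
    induction hy using Submodule.span_induction with
    | mem y hy =>
      obtain ⟨h, rfl⟩ := hy
      exact Submodule.subset_span ⟨g * h, by simp only [map_mul, mul_smul]⟩
    | zero => rw [smul_zero]; exact S.zero_mem
    | add a b _ _ ha hb => rw [smul_add]; exact S.add_mem ha hb
    | smul c a _ ha =>
      have : of F G g • c • a = c • of F G g • a :=
        ZMod.map_smul (DistribSMul.toAddMonoidHom M (of F G g)) c a
      rw [this]
      exact S.smul_mem c ha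
  have : Module.Finite (ZMod p) S := Module.Finite.span_of_finite _ (Set.finite_range _)
  have : Finite S := Module.finite_of_finite (ZMod p)
  let _ : MulAction G S :=
    { smul g y := ⟨of F G g • (y : M), hS g y y.2⟩
      one_smul y := Subtype.ext (by
        change of F G 1 • (y : M) = y
        rw [map_one, one_smul])
      mul_smul g h y := Subtype.ext (by
        change of F G (g * h) • (y : M) = of F G g • of F G h • (y : M)
        rw [map_mul, mul_smul]) }
  have hnt : Nontrivial S := ⟨⟨⟨x, hxS⟩, 0, fun h => hx (congrArg Subtype.val h)⟩⟩
  have hcard : p ∣ Nat.card S := by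
    rw [Module.natCard_eq_pow_finrank (K := ZMod p), Nat.card_zmod]
    exact dvd_pow_self p Module.finrank_pos.ne'
  have h0 : (0 : S) ∈ MulAction.fixedPoints G S := fun g => Subtype.ext (smul_zero _)
  obtain ⟨y, hy, hy0⟩ := hG.exists_fixed_point_of_prime_dvd_card_of_fixed_point S hcard h0
  exact ⟨y, fun h => hy0 (Subtype.ext h.symm), fun g => congrArg Subtype.val (hy g)⟩

theorem smul_eq_zero_of_mem_augIdeal {M : Type*} [AddCommGroup M] [Module (MonoidAlgebra F G) M]
    {m : M} (hm : ∀ g : G, of F G g • m = m) {x : MonoidAlgebra F G} (hx : x ∈ augIdeal F G) :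
    x • m = 0 := by
  have := Fintype.ofFinite G
  rw [eq_sum_smul_of_sub_one hx, Finset.sum_smul]
  refine Finset.sum_eq_zero fun g _ => ?_
  rw [Algebra.smul_def, mul_smul, sub_smul, hm, one_smul, sub_self, smul_zero]

/-- Outside of every proper left ideal there is an element that is invariant modulo the ideal. -/
theorem exists_not_mem_forall_mul_mem (hG : IsPGroup p G) {W : Ideal (MonoidAlgebra F G)}
    (hW : W ≠ ⊤) : ∃ w, w ∉ W ∧ ∀ x ∈ augIdeal F G, x * w ∈ W := by
  have : Nontrivial (MonoidAlgebra F G ⧸ W) := Submodule.Quotient.nontrivial_iff.2 hW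
  obtain ⟨q, hq0, hq⟩ := exists_ne_zero_forall_of_smul_eq (F := F) hG (MonoidAlgebra F G ⧸ W)
  obtain ⟨w, rfl⟩ := Submodule.Quotient.mk_surjective W q
  refine ⟨w, fun h => hq0 ((Submodule.Quotient.mk_eq_zero W).2 h), fun x hx => ?_⟩
  rw [← Submodule.Quotient.mk_eq_zero W, ← smul_eq_mul, Submodule.Quotient.mk_smul]
  exact smul_eq_zero_of_mem_augIdeal hq hx

/-- The augmentation ideal of the group algebra of a finite `p`-group in characteristic `p` is
nilpotent. -/
theorem exists_augIdeal_pow_eq_bot (hG : IsPGroup p G) : ∃ n, augIdeal F G ^ n = ⊥ := by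
  -- A maximal left ideal among those killed by a power of `J` is the whole algebra: otherwise
  -- adjoin a `w` with `J w ⊆ W`, at the cost of one more factor `J`.
  let P : Set (Ideal (MonoidAlgebra F G)) :=
    {W | ∃ n, ∀ x ∈ augIdeal F G ^ n, ∀ w ∈ W, x * w = 0}
  have : IsNoetherianRing (MonoidAlgebra F G) := IsNoetherianRing.of_finite F _
  obtain ⟨W, ⟨n, hn⟩, hmax⟩ :=
    (wellFounded_gt (α := Ideal (MonoidAlgebra F G))).has_min P
    ⟨⊥, 0, fun x _ w hw => by rw [(Submodule.mem_bot _).1 hw, mul_zero]⟩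
  by_cases hW : W = ⊤
  · refine ⟨n, (Submodule.eq_bot_iff _).2 fun x hx => ?_⟩
    rw [← mul_one x]
    exact hn x hx 1 (hW ▸ Submodule.mem_top)
  obtain ⟨w, hw, hJ⟩ := exists_not_mem_forall_mul_mem hG hW
  have hlt : W < W ⊔ Ideal.span {w} :=
    left_lt_sup.2 fun h => hw (h (Ideal.mem_span_singleton_self w))
  have hmem : W ⊔ Ideal.span {w} ∈ P := by
    refine ⟨n + 1, fun x hx v hv => ?_⟩
    obtain ⟨u, hu, v', hv', rfl⟩ := Submodule.mem_sup.1 hv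
    obtain ⟨b, rfl⟩ := Ideal.mem_span_singleton'.1 hv'
    rw [pow_succ] at hx
    induction hx using Submodule.mul_induction_on' with
    | mem_mul_mem y hy z hz =>
      rw [mul_assoc]
      refine hn y hy _ ?_
      rw [mul_add, ← mul_assoc z]
      exact W.add_mem (W.mul_mem_left z hu) (hJ _ (mul_mem_augIdeal_right b hz))
    | add a _ b _ iha ihb => rw [add_mul, iha, ihb, add_zero]
  exact (hmax _ hmem hlt).elim

/-- A subalgebra of the group algebra of a finite `p`-group that generates the augmentation ideal
modulo its square is everything. -/
theorem subalgebra_eq_top (hG : IsPGroup p G) (B : Subalgebra F (MonoidAlgebra F G))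
    (hB : ∀ g, of F G g - 1 ∈ Subalgebra.toSubmodule B ⊔ augIdeal F G * augIdeal F G) :
    B = ⊤ := by
  set J := augIdeal F G with hJ
  let C : Submodule F (MonoidAlgebra F G) := Subalgebra.toSubmodule B ⊓ J
  have hJJ : J * J ≤ J := augIdeal_mul_le
  have hCC : C * C ≤ C := le_inf
    ((mul_le_mul' inf_le_left inf_le_left).trans B.isIdempotentElem_toSubmodule.le)
    ((mul_le_mul' inf_le_right inf_le_right).trans hJJ)
  have h1 : J ≤ C ⊔ J * J := by
    refine augIdeal_le_iff.2 fun g => ?_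
    obtain ⟨b, hb, j, hj, e⟩ := Submodule.mem_sup.1 (hB g)
    rw [← e]
    refine Submodule.add_mem_sup ⟨hb, ?_⟩ hj
    rw [← eq_sub_iff_add_eq] at e
    rw [e]
    exact J.sub_mem (of_sub_one_mem g) (hJJ hj)
  have hpow : ∀ k, J ^ (k + 1) ≤ J := fun k => by
    induction k with
    | zero => simp
    | succ k ih =>
      rw [pow_succ]
      exact (mul_le_mul' ih le_rfl).trans hJJ
  -- Substitute the inclusion into both factors of `J * J`: `C * C` stays in `C`, and every other
  -- product lies in `J ^ (k + 2)`.
  have h2 : ∀ k, J ≤ C ⊔ J ^ (k + 1) := fun k => by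
    induction k with
    | zero => simp
    | succ k ih =>
      refine h1.trans (sup_le le_sup_left ?_)
      refine (mul_le_mul' ih ih).trans ?_
      rw [Submodule.sup_mul, Submodule.mul_sup, Submodule.mul_sup]
      refine sup_le (sup_le (hCC.trans le_sup_left) ?_) (sup_le ?_ ?_) <;>
        refine le_trans ?_ le_sup_right
      · rw [pow_succ' J (k + 1)]
        exact mul_le_mul' inf_le_right le_rfl
      · rw [pow_succ J (k + 1)]
        exact mul_le_mul' le_rfl inf_le_right
      · rw [pow_succ J (k + 1)]
        exact mul_le_mul' le_rfl (hpow k)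
  obtain ⟨n, hn⟩ := exists_augIdeal_pow_eq_bot (F := F) hG
  have h3 : J ≤ Subalgebra.toSubmodule B := by
    refine (h2 n).trans (sup_le inf_le_left ?_)
    rw [pow_succ, hJ, hn, Submodule.bot_mul]
    exact bot_le
  refine eq_top_iff.2 fun x _ => ?_
  have hx : x - algebraMap F _ (aug F G x) ∈ J := by
    rw [hJ, mem_augIdeal, map_sub, AlgHom.commutes]
    simp
  have := B.add_mem (h3 hx) (B.algebraMap_mem (aug F G x))
  rwa [sub_add_cancel] at this

end Nilpotent

/-! ### Cancellation of elementary abelian factors -/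

section Cancellation

theorem IsElementaryAbelian.isPGroup {p : ℕ} {T : Type*} [Group T] (hT : IsElementaryAbelian p T) :
    IsPGroup p T := fun t => ⟨1, by rw [pow_one, hT.2]⟩

theorem IsElementaryAbelian.prod {p : ℕ} {T U : Type*} [Group T] [Group U]
    (hT : IsElementaryAbelian p T) (hU : IsElementaryAbelian p U) :
    IsElementaryAbelian p (T × U) :=
  ⟨fun _ _ => Prod.ext (hT.1 _ _) (hU.1 _ _), fun _ => Prod.ext (hT.2 _) (hU.2 _)⟩

theorem isPGroup_prod {p : ℕ} {T U : Type*} [Group T] [Group U] (hT : IsPGroup p T)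
    (hU : IsPGroup p U) : IsPGroup p (T × U) := by
  rw [isPGroup_iff_pow_pow_eq_one] at *
  rintro ⟨t, u⟩
  obtain ⟨m, hm⟩ := hT t
  obtain ⟨n, hn⟩ := hU u
  exact ⟨m + n, Prod.ext (by simp [pow_add, pow_mul, hm]) (by
    simp [pow_add, mul_comm (p ^ m), pow_mul, hn])⟩

variable {p : ℕ} [Fact p.Prime] {F : Type*} [Field F] [CharP F p]

/-- The condition that every central element `s` of `G` with `s ^ p = 1` satisfies
`s - 1 ∈ J ^ 2`, where `J` is the augmentation ideal of the group algebra. -/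
def IsSocleReduced (p : ℕ) (F : Type*) [Field F] (G : Type*) [Group G] : Prop :=
  ∀ s ∈ Subgroup.center G, s ^ p = 1 → of F G s - 1 ∈ augIdeal F G * augIdeal F G

variable {T U S V : Type*} [Group T] [Group U] [Group S] [Group V] [Finite T] [Finite U]
  [Finite S] [Finite V]

/-- Given an isomorphism `F[T × U] ≃ F[S × V]` with `T`, `S` elementary abelian and `U` socle
reduced, the algebra `F[U]` is a quotient of `F[V]`. -/
theorem exists_surjective_of_equiv (hT : IsElementaryAbelian p T) (hS : IsElementaryAbelian p S)
    (hU : IsPGroup p U) (hV : IsPGroup p V) (hUr : IsSocleReduced p F U)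
    (φ : MonoidAlgebra F (T × U) ≃ₐ[F] MonoidAlgebra F (S × V)) :
    ∃ ψ : MonoidAlgebra F V →ₐ[F] MonoidAlgebra F U, Function.Surjective ψ := by
  have hG : IsPGroup p (T × U) := isPGroup_prod hT.isPGroup hU
  have hH : IsPGroup p (S × V) := isPGroup_prod hS.isPGroup hV
  let incl := mapDomainAlgHom F F (MonoidHom.inr S V)
  let proj := (mapDomainAlgHom F F (MonoidHom.snd T U)).comp φ.symm.toAlgHom
  let ψ := proj.comp incl
  refine ⟨ψ, ?_⟩
  -- `B` contains `FV` and the kernel of `proj`, in particular the images of all `t - 1`.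
  let B : Subalgebra F (MonoidAlgebra F (S × V)) := ψ.range.comap proj
  suffices hB : B = ⊤ by
    intro y
    have hy : mapDomainAlgHom F F (MonoidHom.snd T U)
        (mapDomainAlgHom F F (MonoidHom.inr T U) y) = y := by
      have := DFunLike.congr_fun
        (mapDomainAlgHom_comp (R := F) (A := F) (MonoidHom.inr T U) (MonoidHom.snd T U)) y
      rw [MonoidHom.snd_comp_inr, mapDomainAlgHom_id] at this
      exact this.symm
    have h : φ (mapDomainAlgHom F F (MonoidHom.inr T U) y) ∈ B := hB ▸ Algebra.mem_top
    obtain ⟨v, hv⟩ := h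
    refine ⟨v, ?_⟩
    have e : proj (φ (mapDomainAlgHom F F (MonoidHom.inr T U) y)) = y := by
      simpa [proj] using hy
    exact hv.trans e
  let N : Submodule F (MonoidAlgebra F (T × U)) :=
    Submodule.span F (Set.range fun t : T => of F (T × U) (t, 1) - 1) ⊔
      augIdeal F (T × U) * augIdeal F (T × U)
  let N' : Submodule F (MonoidAlgebra F (S × V)) :=
    Subalgebra.toSubmodule B ⊔ augIdeal F (S × V) * augIdeal F (S × V)
  have hN : ∀ s ∈ Subgroup.center (T × U), s ^ p = 1 → of F (T × U) s - 1 ∈ N := by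
    rintro ⟨t, u⟩ hs hsp
    rw [← mem_ker_quotHom N le_sup_right,
      show ((t, u) : T × U) = (t, 1) * MonoidHom.inr T U u by simp]
    refine mul_mem ?_ ?_
    · rw [mem_ker_quotHom]
      exact Submodule.mem_sup_left (Submodule.subset_span ⟨t, rfl⟩)
    · rw [mem_ker_quotHom]
      refine Submodule.mem_sup_right (of_sub_one_map _ (hUr u ?_ (congrArg Prod.snd hsp)))
      rw [Subgroup.mem_center_iff] at hs ⊢
      exact fun g => congrArg Prod.snd (hs (1, g))
  have hNN' : N ≤ N'.comap φ.toLinearMap := by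
    refine sup_le (Submodule.span_le.2 ?_) fun x hx => Submodule.mem_sup_right
      (map_augIdeal_mul_le φ.toAlgHom (aug_map hG φ.toAlgHom) hx)
    rintro _ ⟨t, rfl⟩
    refine Submodule.mem_sup_left ?_
    change proj (φ (of F (T × U) (t, 1) - 1)) ∈ ψ.range
    have : proj (φ (of F (T × U) (t, 1) - 1)) = 0 := by
      change mapDomainAlgHom F F (MonoidHom.snd T U) (φ.symm (φ _)) = 0
      rw [AlgEquiv.symm_apply_apply, map_sub, map_one, sub_eq_zero]
      simp [one_def]
    rw [this]
    exact ψ.range.zero_mem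
  -- Being central with zero `p`-th power is preserved by `φ.symm`, so the element lands in `N`, and
  -- `φ` carries `N` into `N'`.
  have key : ∀ s : S, of F (S × V) (s, 1) - 1 ∈ N' := by
    intro s
    have hz : φ.symm (of F (S × V) (s, 1) - 1) ∈ N := by
      refine mem_of_pow_eq_zero hG le_sup_right hN (fun x => φ.injective ?_) ?_ ?_
      · rw [map_mul, map_mul, AlgEquiv.apply_symm_apply, sub_mul, mul_sub, one_mul, mul_one]
        congr 1
        refine of_commute (fun m => ?_) _
        exact Prod.ext (hS.1 _ _) (by simp)
      · rw [mem_augIdeal]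
        exact (aug_map hH φ.symm.toAlgHom _).trans (of_sub_one_mem _)
      · have : CharP (MonoidAlgebra F (S × V)) p :=
          charP_of_injective_algebraMap (algebraMap F _).injective p
        rw [← map_pow, sub_pow_char_of_commute _ (Commute.one_right _), ← map_pow,
          show ((s, 1) : S × V) ^ p = 1 from Prod.ext (hS.2 s) (one_pow p)]
        rw [map_one, one_pow, sub_self, map_zero]
    have := hNN' hz
    simpa using this
  refine subalgebra_eq_top hH B fun g => ?_
  change _ ∈ N'
  rw [← mem_ker_quotHom N' le_sup_right,
    show g = (g.1, 1) * MonoidHom.inr S V g.2 by simp]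
  refine mul_mem ((mem_ker_quotHom N' _).2 (key g.1)) ((mem_ker_quotHom N' _).2 ?_)
  refine Submodule.mem_sup_left (Subalgebra.sub_mem _ ?_ (one_mem B))
  exact ⟨of F V g.2, by simp [ψ, incl]⟩

theorem finrank_monoidAlgebra (F : Type*) [Field F] (G : Type*) [Group G] [Finite G] :
    Module.finrank F (MonoidAlgebra F G) = Nat.card G := by
  have := Fintype.ofFinite G
  rw [(coeffLinearEquiv F).finrank_eq, Module.finrank_finsupp_self, Nat.card_eq_fintype_card]

theorem card_eq_of_algEquiv {G H : Type*} [Group G] [Finite G] [Group H] [Finite H]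
    (e : MonoidAlgebra F G ≃ₐ[F] MonoidAlgebra F H) : Nat.card G = Nat.card H := by
  rw [← finrank_monoidAlgebra F G, ← finrank_monoidAlgebra F H]
  exact e.toLinearEquiv.finrank_eq

/-- Elementary abelian direct factors can be cancelled in group algebra isomorphisms when the
complements are socle reduced. -/
theorem cancel_elementaryAbelian (hT : IsElementaryAbelian p T) (hS : IsElementaryAbelian p S)
    (hU : IsPGroup p U) (hV : IsPGroup p V) (hUr : IsSocleReduced p F U)
    (hVr : IsSocleReduced p F V)
    (φ : MonoidAlgebra F (T × U) ≃ₐ[F] MonoidAlgebra F (S × V)) :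
    Nat.card T = Nat.card S ∧ Nonempty (MonoidAlgebra F U ≃ₐ[F] MonoidAlgebra F V) := by
  obtain ⟨ψ, hψ⟩ := exists_surjective_of_equiv hT hS hU hV hUr φ
  obtain ⟨χ, hχ⟩ := exists_surjective_of_equiv hS hT hV hU hVr φ.symm
  have h1 := LinearMap.finrank_le_finrank_of_surjective (f := ψ.toLinearMap) hψ
  have h2 := LinearMap.finrank_le_finrank_of_surjective (f := χ.toLinearMap) hχ
  have h := le_antisymm h1 h2
  have hinj : Function.Injective χ :=
    (LinearMap.injective_iff_surjective_of_finrank_eq_finrank (f := χ.toLinearMap) h).2 hχ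
  refine ⟨?_, ⟨AlgEquiv.ofBijective χ ⟨hinj, hχ⟩⟩⟩
  rw [finrank_monoidAlgebra, finrank_monoidAlgebra] at h
  have hc := card_eq_of_algEquiv φ
  rw [Nat.card_prod, Nat.card_prod, h] at hc
  exact Nat.eq_of_mul_eq_mul_right Nat.card_pos hc

end Cancellation

/-! ### Decompositions of groups and the Frattini subgroup -/

section Groups

variable {p : ℕ}

theorem exists_isCompl_of_forall_pow_eq_one [Fact p.Prime] {M : Type*} [CommGroup M]
    (hM : ∀ m : M, m ^ p = 1) (K : Subgroup M) : ∃ C, IsCompl K C := by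
  have inst : Module (ZMod p) (Additive M) := AddCommGroup.zmodModule hM
  let e : Subgroup M ≃o Submodule (ZMod p) (Additive M) :=
    Subgroup.toAddSubgroup.trans (AddSubgroup.toZModSubmodule p)
  obtain ⟨C, hC⟩ := exists_isCompl (e K)
  refine ⟨e.symm C, (e.isCompl_iff).2 ?_⟩
  rwa [e.apply_symm_apply]

theorem IsElementaryAbelian.exists_isCompl [Fact p.Prime] {M : Type*} [Group M]
    (hM : IsElementaryAbelian p M) (K : Subgroup M) : ∃ C, IsCompl K C :=
  let _ : CommGroup M := { ‹Group M› with mul_comm := hM.1 }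
  exists_isCompl_of_forall_pow_eq_one hM.2 K

theorem nonempty_mulEquiv_of_forall_pow_eq_one [Fact p.Prime] {T S : Type*} [CommGroup T]
    [CommGroup S] [Finite T] [Finite S] (hT : ∀ t : T, t ^ p = 1) (hS : ∀ s : S, s ^ p = 1)
    (h : Nat.card T = Nat.card S) : Nonempty (T ≃* S) := by
  have inst : Module (ZMod p) (Additive T) := AddCommGroup.zmodModule hT
  have inst' : Module (ZMod p) (Additive S) := AddCommGroup.zmodModule hS
  have hcard : Nat.card (Additive T) = Nat.card (Additive S) := h
  rw [Module.natCard_eq_pow_finrank (K := ZMod p),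
    Module.natCard_eq_pow_finrank (K := ZMod p) (V := Additive S), Nat.card_zmod] at hcard
  have hfr := Nat.pow_right_injective (Fact.out : p.Prime).two_le hcard
  exact ⟨MulEquiv.toAdditive.symm (LinearEquiv.ofFinrankEq _ _ hfr).toAddEquiv⟩

theorem IsElementaryAbelian.nonempty_mulEquiv [Fact p.Prime] {T S : Type*} [Group T]
    [Group S] [Finite T] [Finite S] (hT : IsElementaryAbelian p T) (hS : IsElementaryAbelian p S)
    (h : Nat.card T = Nat.card S) : Nonempty (T ≃* S) :=
  let _ : CommGroup T := { ‹Group T› with mul_comm := hT.1 }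
  let _ : CommGroup S := { ‹Group S› with mul_comm := hS.1 }
  nonempty_mulEquiv_of_forall_pow_eq_one hT.2 hS.2 h

variable {G : Type*} [Group G]

theorem IsInternalDirectProduct.commute_subtype {T U : Subgroup G}
    (h : IsInternalDirectProduct T U) (t : T) (u : U) : Commute (T.subtype t) (U.subtype u) :=
  h.commute t t.2 u u.2

/-- The isomorphism `T × U ≃ G` of an internal direct product. -/
noncomputable def IsInternalDirectProduct.mulEquiv {T U : Subgroup G}
    (h : IsInternalDirectProduct T U) : T × U ≃* G :=
  MulEquiv.ofBijective
    (MonoidHom.noncommCoprod T.subtype U.subtype h.commute_subtype) <| by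
      refine ⟨?_, ?_⟩
      · rw [MonoidHom.noncommCoprod_injective]
        refine ⟨T.subtype_injective, U.subtype_injective, ?_⟩
        rw [T.range_subtype, U.range_subtype, disjoint_iff, h.inf_eq_bot]
      · rw [← MonoidHom.range_eq_top, MonoidHom.noncommCoprod_range, T.range_subtype,
          U.range_subtype, h.sup_eq_top]

theorem IsInternalDirectProduct.mulEquiv_apply {T U : Subgroup G}
    (h : IsInternalDirectProduct T U) (x : T × U) : h.mulEquiv x = x.1 * x.2 := rfl

theorem IsInternalDirectProduct.mem_center_of_left {T U : Subgroup G}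
    (h : IsInternalDirectProduct T U) (hT : IsElementaryAbelian p T) {t : G} (ht : t ∈ T) :
    t ∈ Subgroup.center G := by
  rw [Subgroup.mem_center_iff]
  intro g
  obtain ⟨⟨a, u⟩, rfl⟩ := h.mulEquiv.surjective g
  have h1 : (a : G) * t = t * a := congrArg Subtype.val (hT.1 a ⟨t, ht⟩)
  rw [h.mulEquiv_apply, mul_assoc, ← h.commute t ht u u.2, ← mul_assoc, h1, mul_assoc]

theorem IsInternalDirectProduct.mem_center_of_right {T U : Subgroup G}
    (h : IsInternalDirectProduct T U) {u : U} (hu : u ∈ Subgroup.center U) :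
    (u : G) ∈ Subgroup.center G := by
  rw [Subgroup.mem_center_iff] at hu ⊢
  intro g
  obtain ⟨⟨a, v⟩, rfl⟩ := h.mulEquiv.surjective g
  have h1 : (v : G) * u = u * v := congrArg Subtype.val (hu v)
  rw [h.mulEquiv_apply, mul_assoc, h1, ← mul_assoc, ← mul_assoc, h.commute a a.2 u u.2]

/-- The projection of `G` onto `U` kills `t`, fixes `s` and respects squares of augmentation ideals.
Correcting `s` by a factor from `T` is therefore harmless. -/
theorem IsInternalDirectProduct.isSocleReduced {F : Type*} [Field F] {T U : Subgroup G}
    (h : IsInternalDirectProduct T U)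
    (hs : ∀ s ∈ U, s ∈ Subgroup.center G → s ^ p = 1 →
      ∃ t ∈ T, of F G (t * s) - 1 ∈ augIdeal F G * augIdeal F G) :
    IsSocleReduced p F U := by
  intro s hsc hsp
  obtain ⟨t, ht, hts⟩ := hs s s.2 (h.mem_center_of_right hsc) (by
    rw [← Subgroup.coe_pow, hsp, Subgroup.coe_one])
  have := of_sub_one_map ((MonoidHom.snd T U).comp h.mulEquiv.symm.toMonoidHom) hts
  have e : h.mulEquiv.symm (t * s) = (⟨t, ht⟩, s) := by
    rw [MulEquiv.symm_apply_eq, h.mulEquiv_apply]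
  rw [MonoidHom.comp_apply,
    show h.mulEquiv.symm.toMonoidHom (t * s) = (⟨t, ht⟩, s) from e] at this
  exact this

theorem isCoatom_ker_of_ne_one [Fact p.Prime] (χ : G →* Multiplicative (ZMod p)) {g : G}
    (hg : χ g ≠ 1) : IsCoatom χ.ker := by
  have hcard : (Nat.card (Multiplicative (ZMod p))).Prime := by
    rw [show Nat.card (Multiplicative (ZMod p)) = Nat.card (ZMod p) from rfl, Nat.card_zmod]
    exact Fact.out
  have : Fact (Nat.card (Multiplicative (ZMod p))).Prime := ⟨hcard⟩
  have hsurj : Function.Surjective χ := by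
    rw [← MonoidHom.range_eq_top]
    refine (Subgroup.eq_bot_or_eq_top_of_prime_card χ.range).resolve_left fun h => hg ?_
    have : χ g ∈ χ.range := ⟨g, rfl⟩
    rwa [h, Subgroup.mem_bot] at this
  have hbot : IsCoatom (⊥ : Subgroup (Multiplicative (ZMod p))) := by
    refine ⟨fun h => hg ?_, fun K hK =>
      (Subgroup.eq_bot_or_eq_top_of_prime_card K).resolve_left hK.ne'⟩
    rw [← Subgroup.mem_bot, h]
    trivial
  exact Subgroup.isCoatom_comap_of_surjective hsurj hbot

/-- The Frattini subgroup lies in the second dimension subgroup in characteristic `p`. -/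
theorem of_sub_one_mem_of_mem_frattini [Fact p.Prime] (F : Type*) [Field F] [CharP F p] {g : G}
    (hg : g ∈ frattini G) : of F G g - 1 ∈ augIdeal F G * augIdeal F G := by
  let N := augIdeal F G * augIdeal F G
  have inst : Module (ZMod p) (MonoidAlgebra F G ⧸ N) :=
    AddCommGroup.zmodModule (nsmul_char_eq_zero F)
  change _ ∈ N
  rw [← Submodule.Quotient.mk_eq_zero N, ← Submodule.mkQ_apply,
    ← Module.forall_dual_apply_eq_zero_iff (ZMod p)]
  intro f
  by_contra hf
  -- A functional over the prime field not vanishing on `g - 1` modulo `J ^ 2` gives a character of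
  -- `G` whose kernel is a maximal subgroup missing `g`.
  let χ : G →* Multiplicative (ZMod p) :=
    (AddMonoidHom.toMultiplicative f.toAddMonoidHom).comp (quotHom N le_rfl)
  have hχ : χ g ≠ 1 := fun h => hf h
  exact hχ (frattini_le_coatom (isCoatom_ker_of_ne_one χ hχ) hg)

variable (p G) in
/-- The subgroup of central elements `s` with `s ^ p = 1`. -/
def centralTorsion : Subgroup G where
  carrier := {s | s ∈ Subgroup.center G ∧ s ^ p = 1}
  one_mem' := ⟨one_mem _, one_pow p⟩
  mul_mem' := by
    rintro a b ⟨ha, ha'⟩ ⟨hb, hb'⟩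
    refine ⟨mul_mem ha hb, ?_⟩
    rw [Commute.mul_pow (Subgroup.mem_center_iff.1 hb a), ha', hb', one_mul]
  inv_mem' := by
    rintro a ⟨ha, ha'⟩
    exact ⟨inv_mem ha, by rw [inv_pow, ha', inv_one]⟩

theorem isElementaryAbelian_of_le_centralTorsion {T : Subgroup G} (hT : T ≤ centralTorsion p G) :
    IsElementaryAbelian p T :=
  ⟨fun a b => Subtype.ext (Subgroup.mem_center_iff.1 (hT b.2).1 a),
    fun a => Subtype.ext (hT a.2).2⟩

theorem centralTorsion_le_soc [Fact p.Prime] : centralTorsion p G ≤ soc G := by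
  rintro s ⟨hs, hsp⟩
  by_cases h1 : s = 1
  · rw [h1]; exact one_mem _
  · refine Subgroup.subset_closure ⟨hs, ?_⟩
    rw [orderOf_eq_prime hsp h1]
    exact Fact.out

/-- Every group is the internal direct product of an elementary abelian `p`-subgroup and a subgroup
whose central elements `s` with `s ^ p = 1` satisfy `s - 1 ∈ J ^ 2`. -/
theorem exists_isInternalDirectProduct [Fact p.Prime] (F : Type*) [Field F] [CharP F p]
    (G : Type*) [Group G] : ∃ T U : Subgroup G, IsInternalDirectProduct T U ∧ IsElementaryAbelian p T ∧
      IsSocleReduced p F U := by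
  let N := augIdeal F G * augIdeal F G
  let δ : G →* Multiplicative (MonoidAlgebra F G ⧸ N) := quotHom N le_rfl
  let Ω := centralTorsion p G
  -- `T` is the part of `Ω` that `δ` maps isomorphically onto `δ(Ω)`; the other factor is the
  -- preimage of a complement `C` of `δ(Ω)`, so its elements in `Ω` have trivial image.
  obtain ⟨T₀, hT₀⟩ := (isElementaryAbelian_of_le_centralTorsion (le_refl Ω)).exists_isCompl
    (δ.comp Ω.subtype).ker
  let T := T₀.map Ω.subtype
  have hTΩ : T ≤ Ω := Subgroup.map_subtype_le T₀
  obtain ⟨C, hC⟩ := exists_isCompl_of_forall_pow_eq_one (p := p)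
    (fun m : Multiplicative (MonoidAlgebra F G ⧸ N) => nsmul_char_eq_zero F m.toAdd) (Ω.map δ)
  have hdisj : ∀ t ∈ T, δ t = 1 → t = 1 := by
    rintro _ ⟨t, ht, rfl⟩ h
    have : t ∈ (δ.comp Ω.subtype).ker ⊓ T₀ := ⟨h, ht⟩
    rw [hT₀.inf_eq_bot, Subgroup.mem_bot] at this
    rw [this, map_one]
  have hlift : ∀ s ∈ Ω, ∃ t ∈ T, δ t = δ s := by
    intro s hs
    have : (⟨s, hs⟩ : Ω) ∈ (δ.comp Ω.subtype).ker ⊔ T₀ := hT₀.sup_eq_top ▸ Subgroup.mem_top _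
    have hn : (δ.comp Ω.subtype).ker.Normal := inferInstance
    obtain ⟨k, hk, t, ht, e⟩ := Subgroup.mem_sup_of_normal_left.1 this
    refine ⟨t, ⟨t, ht, rfl⟩, ?_⟩
    have e' : s = k * t := congrArg Subtype.val e.symm
    have hk' : δ k = 1 := hk
    rw [e', map_mul, hk', one_mul]
  have hprod : IsInternalDirectProduct T (C.comap δ) := by
    refine ⟨fun t ht u _ => (Subgroup.mem_center_iff.1 (hTΩ ht).1 u).symm, ?_, ?_⟩
    · refine (Subgroup.eq_bot_iff_forall _).2 fun t ht => hdisj t ht.1 ?_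
      have : δ t ∈ Ω.map δ ⊓ C := ⟨⟨t, hTΩ ht.1, rfl⟩, ht.2⟩
      rwa [hC.inf_eq_bot, Subgroup.mem_bot] at this
    · refine eq_top_iff.2 fun g _ => ?_
      have : δ g ∈ Ω.map δ ⊔ C := hC.sup_eq_top ▸ Subgroup.mem_top _
      obtain ⟨_, ⟨s, hs, rfl⟩, c, hc, e⟩ := Subgroup.mem_sup.1 this
      obtain ⟨t, ht, hts⟩ := hlift s hs
      have hu : t⁻¹ * g ∈ C.comap δ := by
        rw [Subgroup.mem_comap, map_mul, map_inv, hts, ← e, inv_mul_cancel_left]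
        exact hc
      have := Subgroup.mul_mem_sup ht hu
      rwa [mul_inv_cancel_left] at this
  refine ⟨T, C.comap δ, hprod, isElementaryAbelian_of_le_centralTorsion hTΩ,
    hprod.isSocleReduced fun s hsU hsc hsp => ⟨1, one_mem _, ?_⟩⟩
  rw [one_mul, ← mem_ker_quotHom _ le_rfl, MonoidHom.mem_ker]
  have : δ s ∈ Ω.map δ ⊓ C := ⟨⟨s, ⟨hsc, hsp⟩, rfl⟩, hsU⟩
  rwa [hC.inf_eq_bot, Subgroup.mem_bot] at this

/-- By order and trivial intersection, `T` is a complement of `Soc(G) ∩ Φ(G)` in `Soc(G)`. Hence a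
factor from `T` moves any central `s` with `s ^ p = 1` into `Φ(G)`, where `s - 1 ∈ J ^ 2`. -/
theorem IsElementaryDecomposition.isSocleReduced [Fact p.Prime] [Finite G] (F : Type*) [Field F]
    [CharP F p] {T U : Subgroup G} (h : IsElementaryDecomposition T U) (hT : IsElementaryAbelian p T) :
    IsSocleReduced p F U := by
  refine h.directProduct.isSocleReduced fun s _ hsc hsp => ?_
  have hTsoc : T ≤ soc G := fun t ht => centralTorsion_le_soc (p := p)
    ⟨h.directProduct.mem_center_of_left hT ht, congrArg Subtype.val (hT.2 ⟨t, ht⟩)⟩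
  have hcompl : Subgroup.IsComplement' (T.subgroupOf (soc G))
      ((soc G ⊓ frattini G).subgroupOf (soc G)) := by
    refine Subgroup.isComplement'_of_card_mul_and_disjoint ?_ ?_
    · rw [Nat.card_congr (Subgroup.subgroupOfEquivOfLe hTsoc).toEquiv, h.card_left]
      exact Subgroup.index_mul_card _
    · rw [disjoint_iff, Subgroup.eq_bot_iff_forall]
      intro x hx
      have : (x : G) ∈ T ⊓ frattini G := ⟨hx.1, hx.2.2⟩
      rw [h.inf_frattini, Subgroup.mem_bot] at this
      exact Subtype.ext this
  have hs : s ∈ soc G := centralTorsion_le_soc (p := p) ⟨hsc, hsp⟩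
  obtain ⟨⟨a, b⟩, hab⟩ := hcompl.2 ⟨s, hs⟩
  refine ⟨(a : soc G)⁻¹, inv_mem a.2, ?_⟩
  have e : s = (a : soc G) * (b : soc G) := congrArg Subtype.val hab.symm
  rw [e, inv_mul_cancel_left]
  exact of_sub_one_mem_of_mem_frattini F b.2.2

end Groups

/-! ### Group algebras of direct products -/

section Product

variable {F : Type*} [Field F] {T U S V : Type*} [Group T] [Group U] [Group S] [Group V]

/-- Group algebra isomorphisms are compatible with direct products. -/
theorem nonempty_algEquiv_prod (e : T ≃* S) (f : MonoidAlgebra F U ≃ₐ[F] MonoidAlgebra F V) :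
    Nonempty (MonoidAlgebra F (T × U) ≃ₐ[F] MonoidAlgebra F (S × V)) :=
  -- View `F[T × U]` as the group algebra of `T` over `FU`, then change coefficients and group
  -- separately.
  ⟨(curryAlgEquiv F).trans <| (mapAlgEquiv F T f).trans <|
    (domCongr F (MonoidAlgebra F V) e).trans (curryAlgEquiv F).symm⟩

end Product

end ModularIso

/-! ### The main theorem -/

theorem theorem4p1 (p : ℕ) [Fact p.Prime] (F : Type*) [Field F] [CharP F p]
    (G : Type*) [Group G] [Finite G] (hG : IsPGroup p G)
    (H : Type*) [Group H] [Finite H] (hH : IsPGroup p H) :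
    (∀ (T U : Subgroup G) (S V : Subgroup H),
      ModularIso.IsElementaryDecomposition T U →
      ModularIso.IsElementaryDecomposition S V →
      ModularIso.IsElementaryAbelian p T →
      ModularIso.IsElementaryAbelian p S →
      (Nonempty (MonoidAlgebra F G ≃ₐ[F] MonoidAlgebra F H) ↔
        Nonempty (MonoidAlgebra F T ≃ₐ[F] MonoidAlgebra F S) ∧
          Nonempty (MonoidAlgebra F U ≃ₐ[F] MonoidAlgebra F V))) ∧
    (∀ (E : Type*) [Group E] [Finite E], ModularIso.IsElementaryAbelian p E →
      Nonempty (MonoidAlgebra F (E × G) ≃ₐ[F] MonoidAlgebra F (E × H)) →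
      Nonempty (MonoidAlgebra F G ≃ₐ[F] MonoidAlgebra F H)) := by
  refine ⟨fun T U S V hTU hSV hT hS => ⟨?_, ?_⟩, fun E _ _ hE => ?_⟩
  · rintro ⟨φ⟩
    have h := ModularIso.cancel_elementaryAbelian hT hS (hG.to_subgroup U) (hH.to_subgroup V)
      (hTU.isSocleReduced F hT) (hSV.isSocleReduced F hS)
      ((MonoidAlgebra.domCongr F F hTU.directProduct.mulEquiv).trans <|
        φ.trans (MonoidAlgebra.domCongr F F hSV.directProduct.mulEquiv).symm)
    obtain ⟨e⟩ := hT.nonempty_mulEquiv hS h.1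
    exact ⟨⟨MonoidAlgebra.domCongr F F e⟩, h.2⟩
  · rintro ⟨⟨ψ⟩, ⟨χ⟩⟩
    obtain ⟨e⟩ := hT.nonempty_mulEquiv hS (ModularIso.card_eq_of_algEquiv ψ)
    obtain ⟨φ⟩ := ModularIso.nonempty_algEquiv_prod e χ
    exact ⟨(MonoidAlgebra.domCongr F F hTU.directProduct.mulEquiv).symm.trans <|
      φ.trans (MonoidAlgebra.domCongr F F hSV.directProduct.mulEquiv)⟩
  · rintro ⟨φ⟩
    obtain ⟨T, U, hTU, hT, hU⟩ := ModularIso.exists_isInternalDirectProduct (p := p) F G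
    obtain ⟨S, V, hSV, hS, hV⟩ := ModularIso.exists_isInternalDirectProduct (p := p) F H
    -- Regroup so that `E × T` and `E × S` are the factors to cancel; comparing orders then gives
    -- `|T| = |S|`.
    let eG : (E × T) × U ≃* E × G :=
      MulEquiv.prodAssoc.trans ((MulEquiv.refl E).prodCongr hTU.mulEquiv)
    let eH : (E × S) × V ≃* E × H :=
      MulEquiv.prodAssoc.trans ((MulEquiv.refl E).prodCongr hSV.mulEquiv)
    have h := ModularIso.cancel_elementaryAbelian (hE.prod hT) (hE.prod hS) (hG.to_subgroup U)
      (hH.to_subgroup V) hU hV ((MonoidAlgebra.domCongr F F eG).trans <|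
        φ.trans (MonoidAlgebra.domCongr F F eH).symm)
    obtain ⟨hc, ⟨χ⟩⟩ := h
    rw [Nat.card_prod, Nat.card_prod] at hc
    obtain ⟨e⟩ := hT.nonempty_mulEquiv hS (Nat.eq_of_mul_eq_mul_left Nat.card_pos hc)
    obtain ⟨ψ⟩ := ModularIso.nonempty_algEquiv_prod e χ
    exact ⟨(MonoidAlgebra.domCongr F F hTU.mulEquiv).symm.trans <|
      ψ.trans (MonoidAlgebra.domCongr F F hSV.mulEquiv)⟩
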